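/- Let $G=(V,E)$ be a finite connected graph (loops and multiple edges are allowed) with a fixed orientation: $E^+$ denotes the set of positively oriented edges, one for each geometric edge, and $e\in E^+$ goes from $\underline e$ to $\overline e$. Let $(x_e)_{e\in E^+}$ be positive real weights, and let $\mathbb K=\mathbb R$ or $\mathbb C$. Let $\Omega^1(G)$ be the space of $\mathbb K$-valued $1$-forms (antisymmetric functions on oriented edges, determined by their values on $E^+$) with the inner product $\langle\alpha,\beta\rangle=\sum_{e\in E^+}x_e\overline{\alpha_e}\beta_e$. Let $d:\mathbb K^V\to\Omega^1(G)$ be the differential $(df)_e=f(\overline e)-f(\underline e)$. Let $(\omega_e)_{e\in E^+}$ be the orthonormal basis $\omega_e=e^\star/\sqrt{x_e}$ of $\Omega^1(G)$, where $e^\star$ is the $1$-form equal to $1$ at $e$ and to $0$ at the other elements of $E^+$. Spanning subgraphs of $G$ are identified with subsets of $E^+$. For a spanning subgraph $K$, let $Z_1(K,\mathbb Z)$ be the group of integral $1$-chains $c$ supported on $K$ with zero boundary $\sum_e c_e(\overline e-\underline e)$. For an integer $k\ge 0$, let $\mathcal C_k(G)$ be the set of connected spanning subgraphs $K$ such that $Z_1(K,\mathbb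 Z)$ has rank $k$. For $K\in\mathcal C_k(G)$, let $z_K=\gamma_1\wedge\dots\wedge\gamma_k$, where $(\gamma_1,\dots,\gamma_k)$ is any $\mathbb Z$-basis of $Z_1(K,\mathbb Z)$. Write $x^K=\prod_{e\in K}x_e$, and let $(\cdot,\cdot)$ be the pairing of the $k$-th exterior powers of $1$-forms and of $1$-chains, so that $(\theta_1\wedge\dots\wedge\theta_k,\,\gamma_1\wedge\dots\wedge\gamma_k)=\det\big(\theta_i(\gamma_j)\big)_{i,j}$ with $\theta(\gamma)=\sum_{e\in E^+}\theta_e\gamma_e$. Let $\Theta$ be a $k$-dimensional linear subspace of $\Omega^1(G)$ such that $\Theta\cap\operatorname{im}d=\{0\}$, and let $\vartheta$ be the exterior product of the elements of a basis of $\Theta$. Then the measure on $\mathcal C_k(G)$ which assigns to $K$ the weight $$x^K\,|(\vartheta,z_K)|^2$$ is not zero, and the corresponding normalized probability measure is determinantal, associated with the orthogonal projection $\Pi$ of $\Omega^1(G)$ onto $\operatorname{im}d\oplus\Theta$. That is, if $\mathsf X$ is a random subset of $E^+$ with this law, then for every $J\subseteq E^+$, $$\mathbb P(J\subseteq\mathsf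 X)=\det\big(\langle\omega_e,\Pi\,\omega_{e'}\rangle\big)_{e,e'\in J}.$$ -/

import Mathlib

/-- A finite graph (loops and multiple edges allowed) with vertex set `V`, a fixed orientation, and
positive edge weights. `E` is the set `E⁺` of positively oriented edges, one for each geometric
edge; `src e` and `tgt e` are the starting and ending vertices of `e`. -/
structure WeightedGraph (V E : Type*) where
  src : E → V
  tgt : E → V
  weight : E → ℝ
  weight_pos : ∀ e, 0 < weight e

namespace WeightedGraph

noncomputable section

variable {V E : Type*}

/-! ### Spanning subgraphs, chains and cycles -/

/-- The spanning subgraph of `G` with edge set `S` is connected. -/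
def ConnectedOn (G : WeightedGraph V E) (S : Finset E) : Prop :=
  (SimpleGraph.fromRel fun u v => ∃ e ∈ S, G.src e = u ∧ G.tgt e = v).Connected

/-- The graph `G` is connected (in particular `V` is not empty). -/
def Connected [Fintype E] (G : WeightedGraph V E) : Prop :=
  G.ConnectedOn Finset.univ

/-- The boundary operator `∂ : C₁(G, ℤ) → C₀(G, ℤ)`, `∂ e = tgt e - src e`, where the groups of
chains are identified with `E → ℤ` and `V → ℤ` through their canonical bases. -/
def boundary [Fintype E] [DecidableEq V] (G : WeightedGraph V E) : (E → ℤ) →ₗ[ℤ] (V → ℤ) where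
  toFun c := ∑ e, c e • (Pi.single (G.tgt e) 1 - Pi.single (G.src e) 1)
  map_add' a b := by simp only [Pi.add_apply, add_smul, Finset.sum_add_distrib]
  map_smul' m a := by
    simp only [Pi.smul_apply, smul_eq_mul, mul_smul, Finset.smul_sum, RingHom.id_apply]

/-- The group `Z₁(S, ℤ)` of cycles of the spanning subgraph with edge set `S`: the integral
`1`-chains with zero boundary that are supported on `S`. -/
def cycles [Fintype E] [DecidableEq V] (G : WeightedGraph V E) (S : Finset E) :
    Submodule ℤ (E → ℤ) where
  carrier := {c | G.boundary c = 0 ∧ ∀ e, e ∉ S → c e = 0}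
  zero_mem' := ⟨map_zero _, fun _ _ => rfl⟩
  add_mem' := by
    rintro a b ⟨ha, ha'⟩ ⟨hb, hb'⟩
    exact ⟨by rw [map_add, ha, hb, add_zero], fun e he => by simp [ha' e he, hb' e he]⟩
  smul_mem' := by
    rintro m a ⟨ha, ha'⟩
    exact ⟨by rw [map_smul, ha, smul_zero], fun e he => by simp [ha' e he]⟩

/-- The set `C_k(G)` of connected spanning subgraphs of `G` with first Betti number `k`. A spanning
subgraph is given by its set of (positively oriented) edges. -/
def connectedSubgraphs [Fintype E] [DecidableEq V] (G : WeightedGraph V E) (k : ℕ) :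
    Set (Finset E) :=
  {K | G.ConnectedOn K ∧ Module.finrank ℤ (G.cycles K) = k}

/-- A subgraph with first Betti number `k` has an integral basis of cycles with `k` elements. -/
theorem nonempty_cycleBasis [Fintype E] [DecidableEq V] (G : WeightedGraph V E) {k : ℕ}
    {K : Finset E} (hK : K ∈ G.connectedSubgraphs k) :
    Nonempty (Module.Basis (Fin k) ℤ (G.cycles K)) :=
  ⟨Module.finBasisOfFinrankEq ℤ (G.cycles K) hK.2⟩

/-! ### Differential forms and the weighted inner product -/

/-- The inner product `⟨⟨α, β⟩⟩ = ∑ e, x_e * conj (α e) * β e`. -/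
@[reducible]
def innerCore [Fintype E] (G : WeightedGraph V E) (𝕜 : Type*) [RCLike 𝕜] :
    InnerProductSpace.Core 𝕜 (E → 𝕜) where
  inner α β := ∑ e, (G.weight e : 𝕜) * ((starRingEnd 𝕜) (α e) * β e)
  conj_inner_symm α β := by
    simp only [map_sum, map_mul, RCLike.conj_ofReal, RCLike.conj_conj]
    exact Finset.sum_congr rfl fun e _ => by ring
  re_inner_nonneg α := by
    rw [map_sum]
    refine Finset.sum_nonneg fun e _ => ?_
    rw [RCLike.conj_mul, ← RCLike.ofReal_pow, ← RCLike.ofReal_mul, RCLike.ofReal_re]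
    exact mul_nonneg (G.weight_pos e).le (sq_nonneg _)
  add_left α β γ := by
    rw [← Finset.sum_add_distrib]
    exact Finset.sum_congr rfl fun e _ => by simp only [Pi.add_apply, map_add]; ring
  smul_left α β r := by
    rw [Finset.mul_sum]
    exact Finset.sum_congr rfl fun e _ => by
      simp only [Pi.smul_apply, smul_eq_mul, map_mul]; ring
  definite α h := by
    have h' : ∑ e, G.weight e * ‖α e‖ ^ 2 = 0 := by
      have := h
      simp only [RCLike.conj_mul] at this
      exact_mod_cast this
    have h0 := (Finset.sum_eq_zero_iff_of_nonneg fun e _ =>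
      mul_nonneg (G.weight_pos e).le (sq_nonneg ‖α e‖)).1 h'
    funext e
    have := h0 e (Finset.mem_univ e)
    simpa [(G.weight_pos e).ne'] using this

/-- The space `Ω¹(G)` of `1`-forms with values in `𝕜`. An antisymmetric function on the oriented
edges is given by its values on the positively oriented ones. This is a copy of `E → 𝕜` which
carries the weighted inner product of `G`. -/
def OneForm (_G : WeightedGraph V E) (𝕜 : Type*) : Type _ := E → 𝕜

section OneForm

variable [Fintype E] (G : WeightedGraph V E) (𝕜 : Type*) [RCLike 𝕜]

instance : NormedAddCommGroup (G.OneForm 𝕜) :=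
  @InnerProductSpace.Core.toNormedAddCommGroup 𝕜 (E → 𝕜) _ _ _ (G.innerCore 𝕜)

instance : InnerProductSpace 𝕜 (G.OneForm 𝕜) :=
  @InnerProductSpace.ofCore 𝕜 (E → 𝕜) _ _ _ (G.innerCore 𝕜).toCore

instance : FiniteDimensional 𝕜 (G.OneForm 𝕜) :=
  inferInstanceAs (FiniteDimensional 𝕜 (E → 𝕜))

theorem inner_def (α β : G.OneForm 𝕜) :
    inner 𝕜 α β = ∑ e, (G.weight e : 𝕜) * ((starRingEnd 𝕜) (α e) * β e) := rfl

@[simp]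
theorem OneForm.add_apply (α β : G.OneForm 𝕜) (e : E) : (α + β) e = α e + β e := rfl

@[simp]
theorem OneForm.smul_apply (r : 𝕜) (α : G.OneForm 𝕜) (e : E) : (r • α) e = r * α e := rfl

/-- The discrete differential `d : Ω⁰(G) → Ω¹(G)`, `(d f) e = f (tgt e) - f (src e)`. -/
def differential : (V → 𝕜) →ₗ[𝕜] G.OneForm 𝕜 where
  toFun f := fun e => f (G.tgt e) - f (G.src e)
  map_add' f g := by
    funext e
    exact add_sub_add_comm _ _ _ _
  map_smul' r f := by
    funext e
    exact (mul_sub _ _ _).symm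

@[simp]
theorem differential_apply (f : V → 𝕜) (e : E) :
    G.differential 𝕜 f e = f (G.tgt e) - f (G.src e) := rfl

/-- The orthonormal basis `ω_e = e⋆ / √x_e` of `Ω¹(G)`. -/
def omega [DecidableEq E] (e : E) : G.OneForm 𝕜 :=
  fun e' => if e' = e then (((Real.sqrt (G.weight e))⁻¹ : ℝ) : 𝕜) else 0

variable {𝕜} in
/-- The matrix, in the orthonormal basis `(ω_e)`, of the orthogonal projection on a subspace `H`
of `Ω¹(G)`. -/
def projKernel [DecidableEq E] (H : Submodule 𝕜 (G.OneForm 𝕜)) : Matrix E E 𝕜 :=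
  Matrix.of fun e e' => inner 𝕜 (G.omega 𝕜 e) (H.starProjection (G.omega 𝕜 e'))

/-! ### The pairing of forms and chains, and the weights -/

/-- The pairing `(α, c) = ∑ e, α e * c e` between `1`-forms and `1`-chains with coefficients
in `𝕜`. -/
def evalChain : G.OneForm 𝕜 →ₗ[𝕜] Module.Dual 𝕜 (E → 𝕜) :=
  LinearMap.mk₂ 𝕜 (fun (α : G.OneForm 𝕜) (c : E → 𝕜) => ∑ e, α e * c e)
    (fun α β c => by simp only [OneForm.add_apply, add_mul, Finset.sum_add_distrib])
    (fun r α c => by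
      simp only [OneForm.smul_apply, smul_eq_mul, Finset.mul_sum, mul_assoc])
    (fun α c c' => by simp only [Pi.add_apply, mul_add, Finset.sum_add_distrib])
    (fun r α c => by
      simp only [Pi.smul_apply, smul_eq_mul, Finset.mul_sum]
      exact Finset.sum_congr rfl fun e _ => by ring)

/-- The induced pairing `(ϑ, z)` between `⋀ᵏ Ω¹(G)` and the `k`-th exterior power of `1`-chains. -/
def wedgePairing (k : ℕ) :
    ⋀[𝕜]^k (G.OneForm 𝕜) →ₗ[𝕜] Module.Dual 𝕜 (⋀[𝕜]^k (E → 𝕜)) :=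
  exteriorPower.pairingDual 𝕜 (E → 𝕜) k ∘ₗ exteriorPower.map k (G.evalChain 𝕜)

variable {G} in
/-- The element `z_K = γ₁ ∧ ⋯ ∧ γ_k` of the exterior power of `1`-chains, for an integral basis
`γ` of the group of cycles of `K`. -/
def cycleWedge [DecidableEq V] {k : ℕ} {K : Finset E}
    (γ : Module.Basis (Fin k) ℤ (G.cycles K)) : ⋀[𝕜]^k (E → 𝕜) :=
  exteriorPower.ιMulti 𝕜 k fun j e => (((γ j : E → ℤ) e : ℤ) : 𝕜)

variable {𝕜} in
open Classical in
/-- The weight `x^K |(ϑ, z_K)|²` for `K` in `C_k(G)`, extended by `0` to the other spanning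
subgraphs. Here `γ` is a choice of an integral basis of cycles for each `K` in `C_k(G)`. -/
def symanzikWeight [DecidableEq V] {k : ℕ} (ϑ : ⋀[𝕜]^k (G.OneForm 𝕜))
    (γ : ∀ K ∈ G.connectedSubgraphs k, Module.Basis (Fin k) ℤ (G.cycles K))
    (K : Finset E) : ℝ :=
  if hK : K ∈ G.connectedSubgraphs k then
    (∏ e ∈ K, G.weight e) * ‖G.wedgePairing 𝕜 k ϑ (cycleWedge 𝕜 (γ K hK))‖ ^ 2
  else 0

end OneForm

end

end WeightedGraph

/-- `p` is the probability distribution of a random subset `X` of the finite set `E` that is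
determinantal with kernel `M`: `P(J ⊆ X) = det (M e e')_{e, e' ∈ J}` for every `J ⊆ E`. -/
structure IsDeterminantal {E 𝕜 : Type*} [Fintype E] [DecidableEq E] [RCLike 𝕜]
    (p : Finset E → ℝ) (M : Matrix E E 𝕜) : Prop where
  nonneg : ∀ S, 0 ≤ p S
  sum_eq_one : ∑ S, p S = 1
  incidence : ∀ J : Finset E,
    ((∑ S with J ⊆ S, p S : ℝ) : 𝕜) =
      (M.submatrix (fun i : J => (i : E)) (fun i : J => (i : E))).det

/-! Fix a base vertex `v₀` and complete a basis of `Θ` by the forms `d 1_v`, `v ≠ v₀`. Connectedness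
of the graph and `Θ ∩ im d = 0` make this family a basis of `im d ⊕ Θ`. Let `A` be its matrix in
`(ω_e)`; it has `n = k + |V| - 1` columns.

Linear algebra: the projection is `Π = A C` with `A* A C = A*`, so `A* (1 + D) A = A* A (1 + C D A)`
for diagonal `D`. Expanding the determinant of the left side by Cauchy–Binet and that of the right
side in principal minors of `Π`, then comparing coefficients, gives `∑_{S ⊇ J} |det A_S|² = det (A*
A) · det Π_J`, with `S` ranging over sets of `n` edges (`det_mul_det_submatrix_of_mul_mul_eq`).

Topology: `|det A_S|²` is the weight of `S`. If `S` is connected, a cycle basis together with chains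
joining `v₀` to the other vertices is a `ℤ`-basis of `ℤ^S`; this unimodular change of basis makes
the minor block triangular, with blocks `(θ_i(γ_j))` and `1` (`norm_det_extendByDifferential`). If
`S` is disconnected, a locally constant function gives a relation between the rows, so the minor
vanishes (`det_extendByDifferential_eq_zero`). -/

/-- A function on finite sets is determined by its sums over powersets. -/
theorem Finset.eq_of_sum_powerset_eq {E M : Type*} [AddCommGroup M]
    {a b : Finset E → M}
    (h : ∀ U : Finset E, ∑ J ∈ U.powerset, a J = ∑ J ∈ U.powerset, b J) : a = b := by
  classical
  funext U
  induction U using Finset.strongInduction with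
  | H U ih =>
    have hU := h U
    rw [← Finset.insert_erase (Finset.mem_powerset_self U),
      Finset.sum_insert (Finset.notMem_erase _ _), Finset.sum_insert (Finset.notMem_erase _ _)] at hU
    have : ∑ J ∈ U.powerset.erase U, a J = ∑ J ∈ U.powerset.erase U, b J :=
      Finset.sum_congr rfl fun J hJ => ih J <| by
        rw [Finset.mem_erase, Finset.mem_powerset] at hJ
        exact lt_of_le_of_ne hJ.2 hJ.1
    rw [this] at hU
    exact add_right_cancel hU

/-! ### Cauchy–Binet and principal minors of projections -/

namespace Matrix

variable {ι E R : Type*} [Fintype ι] [DecidableEq ι] [Fintype E] [CommRing R]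

/-- Expansion of the determinant of a product of rectangular matrices over all maps between the
index types. -/
theorem det_mul_eq_sum_fun (A : Matrix ι E R) (B : Matrix E ι R) :
    (A * B).det = ∑ f : ι → E, (∏ i, A i (f i)) * (B.submatrix f id).det := by
  have h : (A * B) = fun i => ∑ e, A i e • B e := by
    ext i j
    simp [Matrix.mul_apply]
  rw [h]
  change (detRowAlternating (R := R) (n := ι)).toMultilinearMap (fun i => ∑ e, A i e • B e) = _
  rw [MultilinearMap.map_sum]
  refine Finset.sum_congr rfl fun f _ => ?_
  rw [MultilinearMap.map_smul_univ]
  rfl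

variable [DecidableEq E]

/-- The **Cauchy–Binet formula**, with a diagonal factor. -/
theorem det_mul_diagonal_mul (A : Matrix ι E R) (d : E → R) (B : Matrix E ι R) :
    (A * diagonal d * B).det = ∑ S ∈ Finset.powersetCard (Fintype.card ι) Finset.univ,
      (∏ e ∈ S, d e) * (A.submatrix id (Subtype.val : S → E) *
        B.submatrix (Subtype.val : S → E) id).det := by
  classical
  set F : (ι → E) → R := fun f => (∏ i, A i (f i)) * (B.submatrix f id).det with hF
  have hF0 : ∀ f, ¬ Function.Injective f → F f = 0 := by
    intro f hf
    obtain ⟨i, j, hij, hne⟩ : ∃ i j, f i = f j ∧ i ≠ j := by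
      simpa [Function.Injective] using hf
    rw [hF]
    dsimp only
    rw [det_zero_of_row_eq hne, mul_zero]
    funext l
    simp [hij]
  have hS : ∀ S ∈ Finset.powersetCard (Fintype.card ι) (Finset.univ : Finset E),
      (A.submatrix id (Subtype.val : S → E) * B.submatrix (Subtype.val : S → E) id).det =
        ∑ f with Finset.univ.image f = S, F f := by
    intro S hS
    rw [Finset.mem_powersetCard] at hS
    rw [det_mul_eq_sum_fun]
    -- A map into `S` that misses a point of `S` is not injective, since `S` has as many elements as
    -- `ι`; its term is zero.
    have h1 : ∑ f with Finset.univ.image f = S, F f = ∑ f with ∀ i, f i ∈ S, F f := by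
      refine Finset.sum_subset (fun f hf => ?_) fun f hf hf' => hF0 f fun hinj => hf' ?_
      · rw [Finset.mem_filter] at hf ⊢
        exact ⟨hf.1, fun i => hf.2 ▸ Finset.mem_image_of_mem f (Finset.mem_univ i)⟩
      · rw [Finset.mem_filter] at hf ⊢
        refine ⟨hf.1, Finset.eq_of_subset_of_card_le ?_ ?_⟩
        · intro e he
          obtain ⟨i, -, rfl⟩ := Finset.mem_image.1 he
          exact hf.2 i
        · rw [Finset.card_image_of_injective _ hinj, hS.2, Finset.card_univ]
    rw [h1]
    refine Finset.sum_bij' (fun g _ i => (g i : E))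
      (fun f hf i => ⟨f i, (Finset.mem_filter.1 hf).2 i⟩) ?_ ?_ ?_ ?_ ?_
    · intro g _
      simp
    · intros; simp
    · intros; rfl
    · intros; rfl
    · intro g _
      rfl
  have hmem : ∀ f : ι → E, Function.Injective f →
      Finset.univ.image f ∈ Finset.powersetCard (Fintype.card ι) (Finset.univ : Finset E) := by
    intro f hf
    rw [Finset.mem_powersetCard]
    exact ⟨Finset.subset_univ _, by rw [Finset.card_image_of_injective _ hf, Finset.card_univ]⟩
  rw [det_mul_eq_sum_fun]
  have h2 : ∀ f : ι → E, (∏ i, (A * diagonal d) i (f i)) * (B.submatrix f id).det =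
      (∏ e ∈ Finset.univ.image f, d e) * F f := by
    intro f
    by_cases hf : Function.Injective f
    · rw [Finset.prod_image (fun _ _ _ _ h => hf h), hF]
      simp only [mul_diagonal, Finset.prod_mul_distrib]
      ring
    · have := hF0 f hf
      simp only [mul_diagonal, Finset.prod_mul_distrib]
      rw [this, mul_zero, mul_right_comm]
      exact (congrArg (· * _) this).trans (zero_mul _)
  simp_rw [h2]
  rw [Finset.sum_congr rfl fun S h => congrArg (_ * ·) (hS S h)]
  simp_rw [Finset.mul_sum]
  rw [← Finset.sum_filter_of_ne (p := fun f : ι → E =>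
    Finset.univ.image f ∈ Finset.powersetCard (Fintype.card ι) Finset.univ) fun f _ hne =>
      hmem f (by_contra fun h => hne (by rw [hF0 f h, mul_zero]))]
  -- Group the remaining maps by their image `S`.
  rw [← Finset.sum_fiberwise_of_maps_to (g := fun f : ι → E => Finset.univ.image f)
    (t := Finset.powersetCard (Fintype.card ι) Finset.univ)
    fun f hf => (Finset.mem_filter.1 hf).2]
  refine Finset.sum_congr rfl fun S hS' => ?_
  rw [Finset.filter_filter]
  refine Finset.sum_congr ?_ fun f hf => ?_
  · ext f
    simp only [Finset.mem_filter, Finset.mem_univ, true_and, and_iff_right_iff_imp]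
    rintro rfl
    exact hS'
  · rw [(Finset.mem_filter.1 hf).2]

/-- Expansion of `det (1 + D K)`, with `D` diagonal, in terms of the principal minors of `K`. -/
theorem det_one_add_diagonal_mul (d : E → R) (K : Matrix E E R) :
    (1 + diagonal d * K).det = ∑ J : Finset E, (∏ e ∈ J, d e) *
      (K.submatrix (fun i : J => (i : E)) (fun i : J => (i : E))).det := by
  -- By multilinearity, `J` records the rows taken from `diagonal d * K`; the other rows come from
  -- the identity.
  have h := (detRowAlternating (R := R) (n := E)).map_add_univ
    (diagonal d * K).row (1 : Matrix E E R).row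
  rw [add_comm]
  refine h.trans (Finset.sum_congr rfl fun J _ => ?_)
  refine (det_piecewise_one_eq_submatrix_det (diagonal d * K) J).trans ?_
  have : (diagonal d * K).submatrix (fun i : J => (i : E)) (fun i : J => (i : E)) =
      diagonal (fun i : J => d i) *
        K.submatrix (fun i : J => (i : E)) (fun i : J => (i : E)) := by
    ext i j
    simp [diagonal_mul]
  rw [this, det_mul, det_diagonal, Finset.prod_coe_sort J d]

/-- The principal minors of a matrix `B * C` with `B' * B * C = B'`, which is a projection when
`B' * B` is invertible, in terms of the maximal minors of `B` and `B'`. -/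
theorem det_mul_det_submatrix_of_mul_mul_eq {B : Matrix E ι R} {B' C : Matrix ι E R}
    (h : B' * B * C = B') (J : Finset E) :
    (B' * B).det * ((B * C).submatrix (fun i : J => (i : E)) (fun i : J => (i : E))).det =
      ∑ S ∈ Finset.powersetCard (Fintype.card ι) Finset.univ with J ⊆ S,
        (B'.submatrix id (Subtype.val : S → E) *
          B.submatrix (Subtype.val : S → E) id).det := by
  set g : Finset E → R := fun S => (B'.submatrix id (Subtype.val : S → E) *
          B.submatrix (Subtype.val : S → E) id).det
  -- Both sides are expansions of `det (B' * diagonal (1 + d) * B)`, a generating function in `d`.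
  have key : ∀ d : E → R, ∑ J : Finset E, (∏ e ∈ J, d e) * ((B' * B).det *
      ((B * C).submatrix (fun i : J => (i : E)) (fun i : J => (i : E))).det) =
      ∑ J : Finset E, (∏ e ∈ J, d e) *
        ∑ S ∈ Finset.powersetCard (Fintype.card ι) Finset.univ with J ⊆ S, g S := by
    intro d
    have h1 := det_mul_diagonal_mul B' (1 + d) B
    have h2 : B' * diagonal (1 + d) * B = (B' * B) * (1 + C * (diagonal d * B)) := by
      have : diagonal (1 + d) = 1 + diagonal d := by
        rw [← diagonal_one, diagonal_add]; rfl
      rw [this, Matrix.mul_add, Matrix.mul_add, Matrix.add_mul, Matrix.mul_one, Matrix.mul_one,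
        ← Matrix.mul_assoc (B' * B), h, Matrix.mul_assoc]
    rw [h2, det_mul, det_one_add_mul_comm, Matrix.mul_assoc, det_one_add_diagonal_mul,
      Finset.mul_sum] at h1
    rw [Finset.sum_congr rfl fun J _ => mul_left_comm _ _ _, h1]
    simp_rw [Pi.add_apply, Pi.one_apply, Finset.prod_one_add, Finset.sum_mul, Finset.mul_sum]
    refine Finset.sum_comm' fun S J => ?_
    simp
  refine congrFun (Finset.eq_of_sum_powerset_eq (fun U => ?_)
    (a := fun J => (B' * B).det *
      ((B * C).submatrix (fun i : J => (i : E)) (fun i : J => (i : E))).det)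
    (b := fun J => ∑ S ∈ Finset.powersetCard (Fintype.card ι) Finset.univ with J ⊆ S, g S)) J
  -- Evaluating at indicators of sets `U` and inverting over powersets replaces the comparison of
  -- coefficients.
  have hU := key fun e => if e ∈ U then 1 else 0
  have hp : ∀ J : Finset E, (∏ e ∈ J, if e ∈ U then (1 : R) else 0) =
      if J ∈ U.powerset then 1 else 0 := by
    intro J
    rw [Finset.prod_ite_zero]
    simp [Finset.subset_iff]
  simp_rw [hp, ite_mul, one_mul, zero_mul, Finset.sum_ite_mem, Finset.univ_inter] at hU
  exact hU

end Matrix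

/-! ### Integral chains and cycles of spanning subgraphs -/

namespace WeightedGraph

variable {V E : Type*} (G : WeightedGraph V E)

section Chains

/-- A function on the vertices which is constant along the edges of `S` is constant on the
connected components of the spanning subgraph with edge set `S`. -/
theorem eq_of_reachable {α : Type*} {S : Finset E} {f : V → α}
    (hf : ∀ e ∈ S, f (G.tgt e) = f (G.src e)) {u v : V}
    (h : (SimpleGraph.fromRel fun u v => ∃ e ∈ S, G.src e = u ∧ G.tgt e = v).Reachable u v) :
    f u = f v := by
  obtain ⟨p⟩ := h
  induction p with
  | nil => rfl
  | cons hadj _ ih =>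
    rw [← ih]
    obtain ⟨-, ⟨e, he, rfl, rfl⟩ | ⟨e, he, rfl, rfl⟩⟩ := hadj
    · exact (hf e he).symm
    · exact hf e he

variable [Fintype E] [DecidableEq V]

theorem boundary_single [DecidableEq E] (e : E) :
    G.boundary (Pi.single e 1) = Pi.single (G.tgt e) 1 - Pi.single (G.src e) 1 := by
  change ∑ e', (Pi.single e 1 : E → ℤ) e' • _ = _
  rw [Finset.sum_eq_single e (fun e' _ h => by rw [Pi.single_eq_of_ne h, zero_smul]) (by simp)]
  rw [Pi.single_eq_same, one_smul]

/-- Two vertices in the same connected component of a spanning subgraph are the boundary of a chain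
supported on this subgraph. -/
theorem exists_boundary_eq_of_reachable {S : Finset E} {u v : V}
    (h : (SimpleGraph.fromRel fun u v => ∃ e ∈ S, G.src e = u ∧ G.tgt e = v).Reachable u v) :
    ∃ c : E → ℤ, (∀ e, e ∉ S → c e = 0) ∧
      G.boundary c = Pi.single v 1 - Pi.single u 1 := by
  classical
  obtain ⟨p⟩ := h
  induction p with
  | nil => exact ⟨0, fun _ _ => rfl, by rw [map_zero, sub_self]⟩
  | cons hadj _ ih =>
    obtain ⟨c, hc, hb⟩ := ih
    obtain ⟨-, ⟨e, he, rfl, rfl⟩ | ⟨e, he, rfl, rfl⟩⟩ := hadj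
    · refine ⟨c + Pi.single e 1, fun e' he' => ?_, ?_⟩
      · have : e' ≠ e := fun h => he' (h ▸ he)
        simp [hc e' he', this]
      · rw [map_add, hb, boundary_single]
        abel
    · refine ⟨c - Pi.single e 1, fun e' he' => ?_, ?_⟩
      · have : e' ≠ e := fun h => he' (h ▸ he)
        simp [hc e' he', this]
      · rw [map_sub, hb, boundary_single]
        abel

variable [Fintype V]

/-- The differential is the transpose of the boundary operator. -/
theorem sum_differential_mul (𝕜 : Type*) [RCLike 𝕜] (f : V → 𝕜) (c : E → ℤ) :
    ∑ e, G.differential 𝕜 f e * (c e : 𝕜) = ∑ v, f v * (G.boundary c v : 𝕜) := by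
  have hb : ∀ v, G.boundary c v = ∑ e, c e *
      ((Pi.single (G.tgt e) 1 : V → ℤ) v - (Pi.single (G.src e) 1 : V → ℤ) v) := by
    intro v
    change (∑ e, c e • (Pi.single (G.tgt e) 1 - Pi.single (G.src e) 1 : V → ℤ)) v = _
    simp [Finset.sum_apply]
  simp_rw [hb, Int.cast_sum, Finset.mul_sum]
  rw [Finset.sum_comm]
  refine Finset.sum_congr rfl fun e _ => ?_
  have h1 : ∀ u : V, ∑ v, f v * (((Pi.single u 1 : V → ℤ) v : ℤ) : 𝕜) = f u := by
    intro u
    rw [Finset.sum_eq_single u (fun v _ h => by rw [Pi.single_eq_of_ne h]; simp) (by simp)]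
    simp
  rw [differential_apply, ← h1 (G.tgt e), ← h1 (G.src e), ← Finset.sum_sub_distrib,
    Finset.sum_mul]
  refine Finset.sum_congr rfl fun v _ => ?_
  push_cast
  ring

/-- A constant function has zero differential; pair it with `c`. -/
theorem sum_boundary (c : E → ℤ) : ∑ v, G.boundary c v = 0 := by
  have h := G.sum_differential_mul ℝ (fun _ => 1) c
  simp only [differential_apply, sub_self, zero_mul, Finset.sum_const_zero, one_mul] at h
  exact_mod_cast h.symm

variable {G}

/-- A basis of the cycles of a connected spanning subgraph, completed by chains joining a base
vertex to the other vertices, is a basis of the chains supported on this subgraph. -/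
theorem exists_chainBasis {S : Finset E} {k : ℕ} (γ : Module.Basis (Fin k) ℤ (G.cycles S)) (v₀ : V)
    {c : {v : V // v ≠ v₀} → E → ℤ} (hc : ∀ v, ∀ e, e ∉ S → c v e = 0)
    (hb : ∀ v, G.boundary (c v) = Pi.single (v : V) 1 - Pi.single v₀ 1) :
    ∃ b : Module.Basis (Fin k ⊕ {v : V // v ≠ v₀}) ℤ (S → ℤ),
      ∀ i e, b i e = Sum.elim (fun j => (γ j : E → ℤ)) c i e := by
  classical
  set P : Fin k ⊕ {v : V // v ≠ v₀} → E → ℤ := Sum.elim (fun j => (γ j : E → ℤ)) c with hP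
  have hPS : ∀ i, ∀ e, e ∉ S → P i e = 0 := by
    rintro (j | v) e he
    · exact (γ j).2.2 e he
    · exact hc v e he
  -- Away from `v₀`, the boundary kills the cycles and sends the `c v` to the coordinate vectors, so
  -- it reads off the coefficients of the `c v`.
  have hcoord : ∀ u v : {v : V // v ≠ v₀}, G.boundary (c v) u = if u = v then 1 else 0 := by
    intro u v
    rw [hb]
    simp [Pi.single_apply, u.2, Subtype.ext_iff]
  have hγ : ∀ j, G.boundary (γ j : E → ℤ) = 0 := fun j => (γ j).2.1
  have hli : LinearIndependent ℤ fun i => fun e : S => P i e := by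
    rw [Fintype.linearIndependent_iff]
    intro a ha
    have hE : ∑ i, a i • P i = 0 := by
      funext e
      by_cases he : e ∈ S
      · have := congrFun ha ⟨e, he⟩
        simpa [Finset.sum_apply] using this
      · simp [Finset.sum_apply, hPS _ e he]
    rw [Fintype.sum_sum_type] at hE
    simp only [hP, Sum.elim_inl, Sum.elim_inr] at hE
    have hr : ∀ v, a (Sum.inr v) = 0 := by
      intro v
      have := congrFun (congrArg G.boundary hE) v
      simpa [map_sum, Finset.sum_apply, -zsmul_eq_mul, map_smul, hγ, hcoord] using this
    have hl : ∀ j, a (Sum.inl j) = 0 := by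
      refine Fintype.linearIndependent_iff.1 γ.linearIndependent (fun j => a (Sum.inl j)) ?_
      ext1
      simpa [hr] using hE
    rintro (j | v)
    · exact hl j
    · exact hr v
  have hsp : ⊤ ≤ Submodule.span ℤ (Set.range fun i => fun e : S => P i e) := by
    intro x _
    let y : E → ℤ := fun e => if h : e ∈ S then x ⟨e, h⟩ else 0
    have hyS : ∀ e, e ∉ S → y e = 0 := fun e he => dif_neg he
    -- Subtracting the joining chains cancels the boundary away from `v₀`. It then vanishes at `v₀`
    -- too, because its coordinates sum to zero, so `r` is a cycle.
    let r : E → ℤ := y - ∑ v : {v : V // v ≠ v₀}, G.boundary y v • c v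
    have hr1 : ∀ u, u ≠ v₀ → G.boundary r u = 0 := by
      intro u hu
      have : ∀ v, G.boundary (c v) u = if (⟨u, hu⟩ : {v : V // v ≠ v₀}) = v then 1 else 0 :=
        fun v => hcoord ⟨u, hu⟩ v
      simp [r, map_sum, Finset.sum_apply, -zsmul_eq_mul, map_smul, this]
    have hr : r ∈ G.cycles S := by
      refine ⟨?_, fun e he => ?_⟩
      · funext u
        by_cases hu : u = v₀
        · have h := G.sum_boundary r
          rw [Finset.sum_eq_single v₀ (fun u _ hu => hr1 u hu) (by simp)] at h
          rw [hu, h]; rfl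
        · exact hr1 u hu
      · simp [r, hyS e he, Finset.sum_apply, hc _ e he]
    obtain ⟨a, ha⟩ : ∃ a : Fin k → ℤ, ∑ j, a j • γ j = ⟨r, hr⟩ := ⟨_, γ.sum_repr ⟨r, hr⟩⟩
    have hrr := congrArg Subtype.val ha
    have hx : x = ∑ i : Fin k ⊕ {v : V // v ≠ v₀}, Sum.elim a (fun v : {v : V // v ≠ v₀} => G.boundary y (v : V)) i •
        fun e : S => P i e := by
      funext e
      have he := congrFun hrr e
      simp only [AddSubmonoidClass.coe_finsetSum, SetLike.val_smul, Finset.sum_apply,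
        Pi.smul_apply, r, Pi.sub_apply] at he
      rw [Fintype.sum_sum_type]
      simp only [Pi.add_apply, Finset.sum_apply, Pi.smul_apply, hP, Sum.elim_inl, Sum.elim_inr]
      rw [he, sub_add_cancel]
      simp [y]
    rw [hx]
    exact Submodule.sum_mem _ fun i _ =>
      Submodule.smul_mem _ _ (Submodule.subset_span (Set.mem_range_self i))
  exact ⟨Module.Basis.mk hli hsp, fun i e => by rw [Module.Basis.mk_apply]⟩

/-- A connected spanning subgraph with first Betti number `k` has `k + (|V| - 1)` edges. -/
theorem card_eq_of_basis {S : Finset E} (hS : G.ConnectedOn S) {k : ℕ}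
    (γ : Module.Basis (Fin k) ℤ (G.cycles S)) (v₀ : V) :
    S.card = k + Fintype.card {v : V // v ≠ v₀} := by
  choose c hc hb using fun v : {v : V // v ≠ v₀} =>
    G.exists_boundary_eq_of_reachable (hS.preconnected v₀ v)
  obtain ⟨b, -⟩ := exists_chainBasis γ v₀ hc hb
  have h := Module.finrank_eq_card_basis b
  rwa [Module.finrank_pi, Fintype.card_coe, Fintype.card_sum, Fintype.card_fin] at h

/-- For connected `S` the Betti number is `|S| - (|V| - 1)`, so fixing it amounts to fixing the size
of `S`, as Cauchy–Binet does. -/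
theorem mem_connectedSubgraphs_iff {k : ℕ} {S : Finset E} (v₀ : V) :
    S ∈ G.connectedSubgraphs k ↔
      G.ConnectedOn S ∧ S.card = Fintype.card (Fin k ⊕ {v : V // v ≠ v₀}) := by
  rw [Fintype.card_sum, Fintype.card_fin]
  refine and_congr_right fun hS => ⟨fun h => ?_, fun h => ?_⟩
  · exact card_eq_of_basis hS (Module.finBasisOfFinrankEq ℤ (G.cycles S) h) v₀
  · have := card_eq_of_basis hS (Module.finBasisOfFinrankEq ℤ (G.cycles S) rfl) v₀
    omega

end Chains

/-! ### Maximal minors as pairings with cycles -/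

section Forms

variable [Fintype E] [DecidableEq V] (𝕜 : Type*) [RCLike 𝕜]

/-- A family of `1`-forms, completed by the differentials of the indicator functions of the vertices
distinct from a base vertex. -/
noncomputable def extendByDifferential {k : ℕ} (θ : Fin k → G.OneForm 𝕜) (v₀ : V) :
    Fin k ⊕ {v : V // v ≠ v₀} → G.OneForm 𝕜 :=
  Sum.elim θ fun v => G.differential 𝕜 (Pi.single (v : V) 1)

variable {G 𝕜} {k : ℕ} (θ : Fin k → G.OneForm 𝕜)

theorem wedgePairing_cycleWedge {S : Finset E} (γ : Module.Basis (Fin k) ℤ (G.cycles S)) :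
    G.wedgePairing 𝕜 k (exteriorPower.ιMulti 𝕜 k θ) (cycleWedge 𝕜 γ) =
      (Matrix.of fun i j => ∑ e, θ i e * (((γ j : E → ℤ) e : ℤ) : 𝕜)).det := by
  -- `exteriorPower.pairingDual` indexes the rows by the chains rather than by the forms.
  rw [← Matrix.det_transpose]
  simp only [wedgePairing, cycleWedge, LinearMap.comp_apply, exteriorPower.map_apply_ιMulti,
    exteriorPower.pairingDual_ιMulti_ιMulti]
  rfl

variable [Fintype V]

/-- On a connected spanning subgraph, the maximal minor of a family of `1`-forms completed by
differentials is, up to sign, the pairing of these forms with a basis of cycles. -/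
theorem norm_det_extendByDifferential {S : Finset E} (hS : G.ConnectedOn S)
    (γ : Module.Basis (Fin k) ℤ (G.cycles S)) (v₀ : V)
    (σ : S ≃ Fin k ⊕ {v : V // v ≠ v₀}) :
    ‖(Matrix.of fun i j => G.extendByDifferential 𝕜 θ v₀ i (σ.symm j)).det‖ =
      ‖G.wedgePairing 𝕜 k (exteriorPower.ιMulti 𝕜 k θ) (cycleWedge 𝕜 γ)‖ := by
  classical
  choose c hc hb using fun v : {v : V // v ≠ v₀} =>
    G.exists_boundary_eq_of_reachable (hS.preconnected v₀ v)
  obtain ⟨b, hbas⟩ := exists_chainBasis γ v₀ hc hb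
  set P : Fin k ⊕ {v : V // v ≠ v₀} → E → ℤ := Sum.elim (fun j => (γ j : E → ℤ)) c with hP
  have hPS : ∀ i, ∀ e, e ∉ S → P i e = 0 := by
    rintro (j | v) e he
    · exact (γ j).2.2 e he
    · exact hc v e he
  set Q : Matrix (Fin k ⊕ {v : V // v ≠ v₀}) (Fin k ⊕ {v : V // v ≠ v₀}) ℤ :=
    Matrix.of fun i j => P j (σ.symm i) with hQ
  -- `Q` expresses one `ℤ`-basis of `ℤ^S` in another, so its determinant is `±1`.
  have hunit : IsUnit Q.det := by
    have h := ((Pi.basisFun ℤ S).reindex σ).isUnit_det b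
    rw [Module.Basis.det_apply] at h
    have hQb : Q = ((Pi.basisFun ℤ S).reindex σ).toMatrix b := by
      ext i j
      simp [hQ, Module.Basis.toMatrix_apply, hbas]
    rw [hQb]
    convert! h
  have hnorm : ‖(Q.map (Int.castRingHom 𝕜)).det‖ = 1 := by
    have h : (Q.map (Int.castRingHom 𝕜)).det = Int.castRingHom 𝕜 Q.det :=
      (RingHom.map_det (Int.castRingHom 𝕜) Q).symm
    rw [h]
    rcases Int.isUnit_iff.1 hunit with h | h <;> rw [h] <;> simp
  -- Multiplying by `Q` evaluates the forms on the chains, all of which are supported on `S`.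
  have hprod : (Matrix.of fun i j => G.extendByDifferential 𝕜 θ v₀ i (σ.symm j)) *
      Q.map (Int.castRingHom 𝕜) =
      Matrix.of fun i j => ∑ e, G.extendByDifferential 𝕜 θ v₀ i e * (P j e : 𝕜) := by
    ext i j
    rw [Matrix.mul_apply, Matrix.of_apply]
    have h1 : ∑ e, G.extendByDifferential 𝕜 θ v₀ i e * (P j e : 𝕜) =
        ∑ e ∈ S, G.extendByDifferential 𝕜 θ v₀ i e * (P j e : 𝕜) :=
      (Finset.sum_subset (Finset.subset_univ S) fun e _ he => by
        rw [hPS j e he, Int.cast_zero, mul_zero]).symm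
    rw [h1, ← Finset.sum_coe_sort S, ← σ.symm.sum_comp]
    rfl
  -- As `d` is the transpose of the boundary, `d 1_u` vanishes on cycles and takes the value
  -- `δ_{uv}` on `c v`.
  have hblock : (Matrix.of fun i j => ∑ e, G.extendByDifferential 𝕜 θ v₀ i e * (P j e : 𝕜)) =
      Matrix.fromBlocks (Matrix.of fun i j => ∑ e, θ i e * (((γ j : E → ℤ) e : ℤ) : 𝕜))
        (Matrix.of fun i v => ∑ e, θ i e * ((c v e : ℤ) : 𝕜)) 0 1 := by
    ext (i | u) (j | v)
    · rfl
    · rfl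
    · change ∑ e, G.differential 𝕜 (Pi.single (u : V) 1) e * (((γ j : E → ℤ) e : ℤ) : 𝕜) = 0
      rw [sum_differential_mul, (γ j).2.1]
      simp
    · change ∑ e, G.differential 𝕜 (Pi.single (u : V) 1) e * ((c v e : ℤ) : 𝕜) =
        (1 : Matrix _ _ 𝕜) u v
      rw [sum_differential_mul, hb, Finset.sum_eq_single (u : V)
        (fun w _ h => by rw [Pi.single_eq_of_ne h, zero_mul]) (by simp)]
      simp [Pi.single_apply, u.2, Matrix.one_apply, Subtype.ext_iff]
  rw [wedgePairing_cycleWedge, ← mul_one ‖_‖, ← hnorm, ← norm_mul, ← Matrix.det_mul, hprod, hblock,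
    Matrix.det_fromBlocks_zero₂₁, Matrix.det_one, mul_one]

theorem sum_smul_differential_single (v₀ : V) (f : V → 𝕜) (hf : f v₀ = 0) :
    ∑ v : {v : V // v ≠ v₀}, f v • G.differential 𝕜 (Pi.single (v : V) 1) =
      G.differential 𝕜 f := by
  simp_rw [← map_smul, ← map_sum]
  congr 1
  funext u
  rw [Finset.sum_apply]
  by_cases hu : u = v₀
  · subst hu
    rw [hf]
    exact Finset.sum_eq_zero fun v _ => by simp [v.2.symm]
  · rw [Finset.sum_eq_single ⟨u, hu⟩ (fun v _ h => ?_) (by simp)]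
    · simp
    · have : u ≠ v := fun h' => h (Subtype.ext h'.symm)
      simp [this]

/-- On a disconnected spanning subgraph, the maximal minors of a family of `1`-forms completed by
differentials vanish. -/
theorem det_extendByDifferential_eq_zero {S : Finset E} (hS : ¬ G.ConnectedOn S) (v₀ : V)
    (σ : S ≃ Fin k ⊕ {v : V // v ≠ v₀}) :
    (Matrix.of fun i j => G.extendByDifferential 𝕜 θ v₀ i (σ.symm j)).det = 0 := by
  classical
  set H := SimpleGraph.fromRel fun u v => ∃ e ∈ S, G.src e = u ∧ G.tgt e = v with hH
  obtain ⟨v₁, hv₁⟩ : ∃ v, ¬ H.Reachable v₀ v := by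
    by_contra! h
    exact hS ((SimpleGraph.connected_iff_exists_forall_reachable _).2 ⟨v₀, h⟩)
  -- The indicator of the complement of the component of `v₀`: it vanishes at `v₀`, is not zero, and
  -- has `d f = 0` on `S`. Its values are the coefficients of a relation between the rows.
  let f : V → 𝕜 := fun v => if H.Reachable v₀ v then 0 else 1
  have hne : v₁ ≠ v₀ := by
    rintro rfl
    exact hv₁ (SimpleGraph.Reachable.refl _)
  have hf0 : f v₀ = 0 := if_pos (SimpleGraph.Reachable.refl _)
  have hfS : ∀ e ∈ S, G.differential 𝕜 f e = 0 := by
    intro e he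
    have hr : H.Reachable (G.src e) (G.tgt e) := by
      -- A loop gives no adjacency in `SimpleGraph.fromRel`.
      by_cases h : G.src e = G.tgt e
      · rw [h]
      · exact SimpleGraph.Adj.reachable ⟨h, Or.inl ⟨e, he, rfl, rfl⟩⟩
    have : H.Reachable v₀ (G.tgt e) ↔ H.Reachable v₀ (G.src e) :=
      ⟨fun h => h.trans hr.symm, fun h => h.trans hr⟩
    simp [f, this]
  refine Matrix.exists_vecMul_eq_zero_iff.1 ⟨Sum.elim 0 fun v => f v, fun h => ?_, ?_⟩
  · have := congrFun h (Sum.inr ⟨v₁, hne⟩)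
    simp [f, hv₁] at this
  · funext j
    have h1 := congrFun (sum_smul_differential_single (G := G) v₀ f hf0) (σ.symm j)
    rw [hfS _ (σ.symm j).2] at h1
    have h2 : ∀ g : {v : V // v ≠ v₀} → G.OneForm 𝕜, ∀ e, (∑ v, g v) e = ∑ v, g v e :=
      fun g e => Finset.sum_apply e Finset.univ (fun v => (g v : E → 𝕜))
    rw [h2] at h1
    simpa [Matrix.vecMul, dotProduct, Fintype.sum_sum_type, extendByDifferential] using h1

end Forms

end WeightedGraph

/-! ### The projection in the orthonormal basis -/

namespace WeightedGraph

variable {V E : Type*} [Fintype E] {G : WeightedGraph V E} {𝕜 : Type*} [RCLike 𝕜]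

section Projection

variable [DecidableEq E]

theorem inner_omega_left (e : E) (α : G.OneForm 𝕜) :
    inner 𝕜 (G.omega 𝕜 e) α = ((Real.sqrt (G.weight e) : ℝ) : 𝕜) * α e := by
  rw [inner_def, Finset.sum_eq_single e (fun e' _ h => by simp [omega, h]) (by simp)]
  have h : G.weight e * (Real.sqrt (G.weight e))⁻¹ = Real.sqrt (G.weight e) := by
    rw [← div_eq_mul_inv, Real.div_sqrt]
  rw [omega, if_pos rfl, RCLike.conj_ofReal, ← mul_assoc, ← RCLike.ofReal_mul, h]

/-- The coordinates of a family of `1`-forms in the orthonormal basis `(ω_e)`. -/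
noncomputable def omegaMatrix {ι : Type*} (h : ι → G.OneForm 𝕜) : Matrix E ι 𝕜 :=
  Matrix.of fun e i => inner 𝕜 (G.omega 𝕜 e) (h i)

variable {ι : Type*} (h : ι → G.OneForm 𝕜)

/-- Parseval's identity in the orthonormal basis `(ω_e)`. -/
theorem conjTranspose_omegaMatrix_mul :
    (omegaMatrix h).conjTranspose * omegaMatrix h = Matrix.gram 𝕜 h := by
  ext i j
  rw [Matrix.mul_apply, Matrix.gram_apply, inner_def]
  refine Finset.sum_congr rfl fun e _ => ?_
  rw [Matrix.conjTranspose_apply, omegaMatrix, Matrix.of_apply, Matrix.of_apply, inner_omega_left,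
    inner_omega_left, ← starRingEnd_apply, map_mul, RCLike.conj_ofReal, mul_mul_mul_comm,
    ← RCLike.ofReal_mul, Real.mul_self_sqrt (G.weight_pos e).le]

/-- The orthogonal projection on the span of a family of `1`-forms in terms of the matrix of
coordinates of this family. -/
theorem exists_projKernel_eq_mul [Fintype ι] {H : Submodule 𝕜 (G.OneForm 𝕜)}
    (hH : Submodule.span 𝕜 (Set.range h) = H) :
    ∃ C : Matrix ι E 𝕜, projKernel G H = omegaMatrix h * C ∧
      (omegaMatrix h).conjTranspose * omegaMatrix h * C = (omegaMatrix h).conjTranspose := by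
  -- The coefficients of `Π ω_e` on the family form column `e` of `C`.
  have hmem : ∀ e, ∃ c : ι → 𝕜, ∑ i, c i • h i = H.starProjection (G.omega 𝕜 e) := by
    intro e
    rw [← Submodule.mem_span_range_iff_exists_fun, hH]
    exact Submodule.starProjection_apply_mem _ _
  choose c hc using hmem
  refine ⟨Matrix.of fun i e => c e i, ?_, ?_⟩
  · ext e e'
    rw [projKernel, Matrix.of_apply, ← hc, inner_sum, Matrix.mul_apply]
    exact Finset.sum_congr rfl fun i _ => by
      rw [inner_smul_right, mul_comm, omegaMatrix, Matrix.of_apply, Matrix.of_apply]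
  · ext i e
    -- `Π` is self-adjoint and fixes `h i`; these are the normal equations.
    have h1 : inner 𝕜 (h i) (H.starProjection (G.omega 𝕜 e)) = inner 𝕜 (h i) (G.omega 𝕜 e) := by
      rw [← Submodule.inner_starProjection_left_eq_right, Submodule.starProjection_eq_self_iff.2]
      rw [← hH]
      exact Submodule.subset_span (Set.mem_range_self i)
    rw [conjTranspose_omegaMatrix_mul, Matrix.mul_apply, Matrix.conjTranspose_apply, omegaMatrix,
      Matrix.of_apply, ← starRingEnd_apply, inner_conj_symm, ← h1, ← hc, inner_sum]
    exact Finset.sum_congr rfl fun j _ => by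
      rw [inner_smul_right, mul_comm, Matrix.of_apply, Matrix.gram_apply]

variable [Fintype ι] [DecidableEq ι]

/-- Once `S` is identified with `ι`, the product is `X* X` with `X` square, and row `e` of `X`
carries a factor `√x_e`; hence `x^S` times a squared minor. -/
theorem det_conjTranspose_mul_omegaMatrix_submatrix {S : Finset E} (σ : S ≃ ι) :
    ((omegaMatrix h).conjTranspose.submatrix id (Subtype.val : S → E) *
      (omegaMatrix h).submatrix (Subtype.val : S → E) id).det =
    (((∏ e ∈ S, G.weight e) * ‖(Matrix.of fun i j => h i (σ.symm j)).det‖ ^ 2 : ℝ) : 𝕜) := by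
  set X : Matrix ι ι 𝕜 := (omegaMatrix h).submatrix (fun i => (σ.symm i : E)) id with hX
  have h1 : (omegaMatrix h).conjTranspose.submatrix id (Subtype.val : S → E) *
      (omegaMatrix h).submatrix (Subtype.val : S → E) id = X.conjTranspose * X := by
    rw [← Matrix.submatrix_id_id (_ * _), ← Matrix.submatrix_mul_equiv _ _ id σ.symm id]
    rfl
  have h2 : X = Matrix.diagonal (fun i => ((Real.sqrt (G.weight (σ.symm i)) : ℝ) : 𝕜)) *
      (Matrix.of fun i j => h i (σ.symm j)).transpose := by
    ext i j
    rw [Matrix.diagonal_mul, hX, Matrix.submatrix_apply, omegaMatrix, Matrix.of_apply,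
      inner_omega_left]
    rfl
  have h3 : ∏ i, Real.sqrt (G.weight (σ.symm i)) ^ 2 = ∏ e ∈ S, G.weight e := by
    rw [← Finset.prod_coe_sort S, ← σ.symm.prod_comp]
    exact Finset.prod_congr rfl fun i _ => Real.sq_sqrt (G.weight_pos _).le
  rw [h1, Matrix.det_mul, Matrix.det_conjTranspose, ← starRingEnd_apply, RCLike.conj_mul,
    ← RCLike.ofReal_pow, h2, Matrix.det_mul, Matrix.det_diagonal, Matrix.det_transpose, norm_mul,
    mul_pow, ← RCLike.ofReal_prod, RCLike.norm_ofReal, sq_abs, ← Finset.prod_pow, h3]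

end Projection

/-! ### Weights as squared minors -/

section Symanzik

variable [DecidableEq V]

theorem symanzikWeight_nonneg {k : ℕ} (ϑ : ⋀[𝕜]^k (G.OneForm 𝕜))
    (γ : ∀ K ∈ G.connectedSubgraphs k, Module.Basis (Fin k) ℤ (G.cycles K)) (K : Finset E) :
    0 ≤ G.symanzikWeight ϑ γ K := by
  rw [symanzikWeight]
  split_ifs
  · exact mul_nonneg (Finset.prod_nonneg fun e _ => (G.weight_pos e).le) (sq_nonneg _)
  · exact le_rfl

variable [Fintype V]

/-- If `d f = 0` and `f v₀ = 0`, then connectedness forces `f = 0`, so the differentials are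
independent; `Θ ∩ im d = 0` keeps them independent of `θ`. -/
theorem linearIndependent_extendByDifferential (hG : G.Connected) {k : ℕ}
    {Θ : Submodule 𝕜 (G.OneForm 𝕜)} (hΘ : Θ ⊓ LinearMap.range (G.differential 𝕜) = ⊥)
    (θ : Module.Basis (Fin k) 𝕜 Θ) (v₀ : V) :
    LinearIndependent 𝕜 (G.extendByDifferential 𝕜 (fun i => (θ i : G.OneForm 𝕜)) v₀) := by
  refine LinearIndependent.sum_type ?_ ?_ ?_
  · exact θ.linearIndependent.map' Θ.subtype Θ.ker_subtype
  · rw [Fintype.linearIndependent_iff]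
    intro a ha v
    let f : V → 𝕜 := fun v => if h : v ≠ v₀ then a ⟨v, h⟩ else 0
    have hf0 : f v₀ = 0 := dif_neg (not_not.2 rfl)
    have hfa : ∀ v : {v : V // v ≠ v₀}, f v = a v := fun v => dif_pos v.2
    have h := sum_smul_differential_single (G := G) v₀ f hf0
    simp_rw [hfa] at h
    rw [ha] at h
    rw [← hfa, ← hf0]
    exact (G.eq_of_reachable (S := Finset.univ)
      (fun e _ => sub_eq_zero.1 (congrFun h e).symm) (hG.preconnected v₀ v)).symm
  · refine Submodule.disjoint_def.2 fun x hx hx' => ?_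
    have : x ∈ Θ ⊓ LinearMap.range (G.differential 𝕜) := by
      refine ⟨Submodule.span_le.2 ?_ hx, Submodule.span_le.2 ?_ hx'⟩
      · rintro _ ⟨i, rfl⟩
        exact (θ i).2
      · rintro _ ⟨v, rfl⟩
        exact ⟨_, rfl⟩
    rwa [hΘ] at this

theorem span_extendByDifferential {k : ℕ} {Θ : Submodule 𝕜 (G.OneForm 𝕜)}
    (θ : Module.Basis (Fin k) 𝕜 Θ) (v₀ : V) :
    Submodule.span 𝕜
      (Set.range (G.extendByDifferential 𝕜 (fun i => (θ i : G.OneForm 𝕜)) v₀)) =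
      LinearMap.range (G.differential 𝕜) ⊔ Θ := by
  have h1 : Submodule.span 𝕜 (Set.range fun i => (θ i : G.OneForm 𝕜)) = Θ := by
    have : (Set.range fun i => (θ i : G.OneForm 𝕜)) = Θ.subtype '' Set.range θ := by
      rw [← Set.range_comp]; rfl
    rw [this, Submodule.span_image, θ.span_eq, Submodule.map_top, Submodule.range_subtype]
  have h2 : Submodule.span 𝕜 (Set.range fun v : {v : V // v ≠ v₀} =>
      G.differential 𝕜 (Pi.single (v : V) 1)) = LinearMap.range (G.differential 𝕜) := by
    refine le_antisymm (Submodule.span_le.2 ?_) ?_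
    · rintro _ ⟨v, rfl⟩
      exact ⟨_, rfl⟩
    · rintro _ ⟨f, rfl⟩
      -- Subtracting a constant makes `f` vanish at `v₀` without changing `d f`.
      have h : G.differential 𝕜 f = G.differential 𝕜 (fun v => f v - f v₀) := by
        funext e
        simp
      rw [h, ← sum_smul_differential_single v₀ (fun v => f v - f v₀) (sub_self _)]
      exact Submodule.sum_mem _ fun v _ =>
        Submodule.smul_mem _ _ (Submodule.subset_span (Set.mem_range_self v))
  rw [extendByDifferential, Set.Sum.elim_range, Submodule.span_union, h1, h2, sup_comm]

variable [DecidableEq E] {k : ℕ} (θ : Fin k → G.OneForm 𝕜)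
  (γ : ∀ K ∈ G.connectedSubgraphs k, Module.Basis (Fin k) ℤ (G.cycles K)) (v₀ : V)

theorem symanzikWeight_eq_det {S : Finset E}
    (hS : S.card = Fintype.card (Fin k ⊕ {v : V // v ≠ v₀})) :
    ((G.symanzikWeight (exteriorPower.ιMulti 𝕜 k θ) γ S : ℝ) : 𝕜) =
      ((omegaMatrix (G.extendByDifferential 𝕜 θ v₀)).conjTranspose.submatrix id
          (Subtype.val : S → E) *
        (omegaMatrix (G.extendByDifferential 𝕜 θ v₀)).submatrix (Subtype.val : S → E) id).det := by
  let σ : S ≃ Fin k ⊕ {v : V // v ≠ v₀} :=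
    Fintype.equivOfCardEq ((Fintype.card_coe S).trans hS)
  rw [det_conjTranspose_mul_omegaMatrix_submatrix _ σ, symanzikWeight]
  congr 1
  by_cases hc : G.ConnectedOn S
  · have hK : S ∈ G.connectedSubgraphs k := (mem_connectedSubgraphs_iff v₀).2 ⟨hc, hS⟩
    rw [dif_pos hK, norm_det_extendByDifferential θ hc (γ S hK)]
  · rw [dif_neg fun hK => hc hK.1, det_extendByDifferential_eq_zero θ hc, norm_zero]
    simp

/-- Sets of any other size lie outside `C_k(G)` and have weight zero, so the restriction on
cardinality loses nothing. -/
theorem sum_symanzikWeight_eq (J : Finset E) :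
    ((∑ S with J ⊆ S, G.symanzikWeight (exteriorPower.ιMulti 𝕜 k θ) γ S : ℝ) : 𝕜) =
      ∑ S ∈ Finset.powersetCard (Fintype.card (Fin k ⊕ {v : V // v ≠ v₀})) Finset.univ with J ⊆ S,
        ((omegaMatrix (G.extendByDifferential 𝕜 θ v₀)).conjTranspose.submatrix id
          (Subtype.val : S → E) *
        (omegaMatrix (G.extendByDifferential 𝕜 θ v₀)).submatrix (Subtype.val : S → E) id).det := by
  rw [RCLike.ofReal_sum]
  symm
  rw [Finset.sum_congr rfl fun S hS => (symanzikWeight_eq_det θ γ v₀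
    (Finset.mem_powersetCard.1 (Finset.mem_filter.1 hS).1).2).symm]
  refine Finset.sum_subset (Finset.filter_subset_filter _ (Finset.subset_univ _))
    fun S hS hS' => ?_
  rw [symanzikWeight, dif_neg, RCLike.ofReal_zero]
  intro hK
  refine hS' (Finset.mem_filter.2 ⟨Finset.mem_powersetCard.2 ⟨Finset.subset_univ _, ?_⟩,
    (Finset.mem_filter.1 hS).2⟩)
  exact ((mem_connectedSubgraphs_iff v₀).1 hK).2

end Symanzik

end WeightedGraph

/-! ### The determinantal law -/

theorem mainTheorem1 {𝕜 : Type*} [RCLike 𝕜] {V E : Type*} [Fintype V] [Fintype E]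
    [DecidableEq V] [DecidableEq E] (G : WeightedGraph V E) (hG : G.Connected) (k : ℕ)
    (Θ : Submodule 𝕜 (G.OneForm 𝕜))
    (hΘ : Θ ⊓ LinearMap.range (G.differential 𝕜) = ⊥)
    (θ : Module.Basis (Fin k) 𝕜 Θ)
    (γ : ∀ K ∈ G.connectedSubgraphs k, Module.Basis (Fin k) ℤ (G.cycles K)) :
    let ϑ : ⋀[𝕜]^k (G.OneForm 𝕜) := exteriorPower.ιMulti 𝕜 k fun i => (θ i : G.OneForm 𝕜)
    let w : Finset E → ℝ := G.symanzikWeight ϑ γ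
    (∑ K, w K) ≠ 0 ∧
      IsDeterminantal (fun K => w K / ∑ K', w K')
        (G.projKernel (LinearMap.range (G.differential 𝕜) ⊔ Θ)) := by
  intro ϑ w
  obtain ⟨v₀⟩ := hG.nonempty
  set h := G.extendByDifferential 𝕜 (fun i => (θ i : G.OneForm 𝕜)) v₀
  obtain ⟨C, hK, hC⟩ := WeightedGraph.exists_projKernel_eq_mul h
    (WeightedGraph.span_extendByDifferential θ v₀)
  have hdet : ((WeightedGraph.omegaMatrix h).conjTranspose *
      WeightedGraph.omegaMatrix h).det ≠ 0 := by
    rw [WeightedGraph.conjTranspose_omegaMatrix_mul]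
    exact Matrix.det_gram_ne_zero_iff_linearIndependent.2
      (WeightedGraph.linearIndependent_extendByDifferential hG hΘ θ v₀)
  have hJ : ∀ J : Finset E, ((∑ S with J ⊆ S, w S : ℝ) : 𝕜) =
      ((WeightedGraph.omegaMatrix h).conjTranspose * WeightedGraph.omegaMatrix h).det *
      ((G.projKernel (LinearMap.range (G.differential 𝕜) ⊔ Θ)).submatrix
        (fun i : J => (i : E)) (fun i : J => (i : E))).det := fun J => by
    rw [hK, Matrix.det_mul_det_submatrix_of_mul_mul_eq hC]
    exact WeightedGraph.sum_symanzikWeight_eq _ γ v₀ J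
  -- For `J = ∅` the minor is `1`: the total mass is the Gram determinant, nonzero by linear
  -- independence.
  have htot : ((∑ S, w S : ℝ) : 𝕜) =
      ((WeightedGraph.omegaMatrix h).conjTranspose * WeightedGraph.omegaMatrix h).det := by
    have h0 := hJ ∅
    rw [Matrix.det_isEmpty (n := (∅ : Finset E)), mul_one, Finset.filter_true_of_mem fun S _ => Finset.empty_subset S]
      at h0
    exact h0
  have hne : (∑ S, w S) ≠ 0 := fun h0 => hdet (by rw [← htot, h0, RCLike.ofReal_zero])
  have hw : ∀ S, 0 ≤ w S := WeightedGraph.symanzikWeight_nonneg ϑ γ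
  refine ⟨hne, fun S => div_nonneg (hw S) (Finset.sum_nonneg fun S _ => hw S), ?_, fun J => ?_⟩
  · rw [← Finset.sum_div, div_self hne]
  · rw [← Finset.sum_div, RCLike.ofReal_div, hJ J, htot, mul_div_cancel_left₀ _ hdet]
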